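/- Let $0<q<1$ and $0\le\omega<1$ be fixed. For $a\in\mathbb{R}$ put $(a;q)_0=1$ and $(a;q)_n=\prod_{k=0}^{n-1}(1-aq^k)$ for $n\ge 1$, and for real $z$ let $$ {}_1\phi_1(0;\omega;q,z)=\sum_{n=0}^{\infty}\frac{(-1)^n q^{n(n-1)/2}}{(\omega;q)_n\,(q;q)_n}\,z^n , $$ with derivative $\frac{\partial}{\partial z}{}_1\phi_1(0;\omega;q,z)$ with respect to $z$. Let $\{\tau_m\}_{m\ge1}$ be a real sequence with $0\le\tau_m<1$ for $m=1,2,3,\ldots$. (i) If $\lim_{m\to\infty}m\tau_m=0$, then for all sufficiently large $m$ $$\operatorname{sgn}\Big(\tfrac{\partial}{\partial z}{}_1\phi_1(0;\omega;q,z)\Big|_{z=q^{-m+\tau_m}}\Big)=(-1)^{m+1}.$$ (ii) If $\lim_{m\to\infty}m\tau_m=+\infty$, then for all sufficiently large $m$ $$\operatorname{sgn}\Big(\tfrac{\partial}{\partial z}{}_1\phi_1(0;\omega;q,z)\Big|_{z=q^{-m+\tau_m}}\Big)=(-1)^{m}.$$ (Corollary) If $\{\tau_m\}_{m\ge1}$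 is any real sequence with $\lim_{m\to\infty}m\tau_m=0$, then for all sufficiently large $m$ the sign of $\frac{\partial}{\partial z}{}_1\phi_1(0;\omega;q,z)$ is constant, equal to $(-1)^{m+1}$, on the open interval $\left]q^{-m+\tau_m},q^{-m}\right[$ (which is empty if $\tau_m\le0$). -/

import Mathlib

open Filter Topology

/-- The finite `q`-shifted factorial `(a;q)_n = (1 - a)(1 - a q) ⋯ (1 - a q^(n-1))`,
with `(a;q)_0 = 1`. -/
def qShiftedFactorial (a q : ℝ) (n : ℕ) : ℝ :=
  ∏ k ∈ Finset.range n, (1 - a * q ^ k)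

/-- The basic hypergeometric function
`₁φ₁(a;b;q,z) = ∑_{n ≥ 0} (a;q)_n / ((b;q)_n (q;q)_n) (-1)^n q^(n(n-1)/2) z^n`
of a real variable `z`. The exponent `n(n-1)/2` is an exact division of natural numbers. -/
noncomputable def basicPhi11 (a b q z : ℝ) : ℝ :=
  ∑' n : ℕ, qShiftedFactorial a q n / (qShiftedFactorial b q n * qShiftedFactorial q q n)
    * ((-1) ^ n * q ^ (n * (n - 1) / 2)) * z ^ n

/-!
Write `θ(w) = ∑_{j ∈ ℤ} (-1)^j q^(j(j-1)/2) w^j` and `g(w) = w θ'(w)`. With `c_n` denoting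
`1 / ((ω;q)_n (q;q)_n)` for `n ≥ 0` and `0` for `n < 0`, the Euler operator applied to
`₁φ₁(0;ω;q,z)` gives the bilateral series `∑ n c_n (-1)^n q^(n(n-1)/2) z^n`. At `z = q^(-m) w` its
largest terms have index near `m`; moving the origin there turns it into
`(-1)^m q^(-m(m+1)/2) w^m ∑_j (m + j) c_{m+j} (-1)^j q^(j(j-1)/2) w^j`
(`sign_deriv_basicPhi11`). Since `c_n` converges geometrically to a constant `C > 0`, the last sum is
`C (m θ(w) + g(w))` with an exponentially small error, uniformly for `w ∈ [q, 1]`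
(`exists_phiCoeff_shift_approx`). With `w = q^τ`, `0 ≤ τ ≤ 1`, the sign is therefore a competition
between `m θ(q^τ)`, which is of size `m τ` for small `τ`, and `g(q^τ)`.

What is needed about `θ` is that `θ(1) = 0`, that `θ(w) ≥ κ (1 - w)(1 - q/w)` on `[q, 1]` for some
`κ > 0` (`exists_le_thetaSum`), and the reflection `g(q/w) = -g(w)`. The lower bound forces
`g(1) < 0`, hence `g(q) > 0`. If `m τ` is small, `m θ(q^τ)` is small and `g(q^τ)` is near
`g(1) < 0` (`exists_eventually_theta_neg`). If `m τ` is large, `m θ(q^τ)` dominates away from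
`w = q`, while near `w = q` both terms are nonnegative and `g` is bounded below by a positive
constant (`exists_eventually_theta_pos`). Both statements are uniform in `τ`, which gives the
assertion about intervals as well.

The lower bound for `θ` replaces the Jacobi triple product. It comes from Euler's case `ω = 0`: the
sums `∑_j (-1)^j q^(j(j-1)/2) w^j / (q;q)_{m+j}` converge to `θ(w)/(q;q)_∞` as `m → ∞`, and recursions
in `m` and in `w` show that they equal `(q/w;q)_m (w;q)_∞`.
-/

/-! ### Bilateral theta series -/

/-- The `j`-th term `(-1)^j q^(j(j-1)/2) w^j` of the theta series, for `j : ℤ`.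
The integer division in the exponent is exact. -/
noncomputable def thetaTerm (q : ℝ) (j : ℤ) (w : ℝ) : ℝ :=
  (-1) ^ j * q ^ (j * (j - 1) / 2) * w ^ j

/-- The theta function `∑_{j ∈ ℤ} (-1)^j q^(j(j-1)/2) w^j`, which is
`(q;q)_∞ (w;q)_∞ (q/w;q)_∞` by the Jacobi triple product. -/
noncomputable def thetaSum (q w : ℝ) : ℝ := ∑' j : ℤ, thetaTerm q j w

/-- The image `∑_{j ∈ ℤ} j (-1)^j q^(j(j-1)/2) w^j` of `thetaSum` under the Euler operator
`w d/dw`. -/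
noncomputable def thetaEuler (q w : ℝ) : ℝ := ∑' j : ℤ, (j : ℝ) * thetaTerm q j w

theorem triangular_add (m j : ℤ) :
    (m + j) * (m + j - 1) / 2 = m * (m - 1) / 2 + j * (j - 1) / 2 + m * j := by
  have h1 := Int.ediv_two_mul_two_of_even (Int.even_mul_pred_self m)
  have h2 := Int.ediv_two_mul_two_of_even (Int.even_mul_pred_self j)
  have h3 := Int.ediv_two_mul_two_of_even (Int.even_mul_pred_self (m + j))
  have h4 : (m + j) * (m + j - 1) = m * (m - 1) + j * (j - 1) + 2 * (m * j) := by ring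
  omega

theorem thetaTerm_add {q w : ℝ} (hq : 0 < q) (hw : 0 < w) (m j : ℤ) :
    thetaTerm q (m + j) w = thetaTerm q m w * thetaTerm q j (q ^ m * w) := by
  unfold thetaTerm
  rw [triangular_add, zpow_add₀ (by norm_num), zpow_add₀ hq.ne', zpow_add₀ hq.ne',
    zpow_add₀ hw.ne', mul_zpow, zpow_mul]
  ring

theorem thetaTerm_scale (q : ℝ) (m j : ℤ) (w : ℝ) :
    thetaTerm q j (q ^ m * w) = (q ^ m) ^ j * thetaTerm q j w := by
  unfold thetaTerm
  rw [mul_zpow]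
  ring

theorem abs_thetaTerm {q w : ℝ} (hq : 0 < q) (hw : 0 < w) (j : ℤ) :
    |thetaTerm q j w| = q ^ (j * (j - 1) / 2) * w ^ j := by
  unfold thetaTerm
  rw [abs_mul, abs_mul, abs_zpow, abs_neg, abs_one, one_zpow, one_mul,
    abs_of_pos (zpow_pos hq _), abs_of_pos (zpow_pos hw _)]

theorem summable_triangular_nat {q r : ℝ} (hq : 0 < q) (hq1 : q < 1) (hr : 0 < r) :
    Summable fun n : ℕ => q ^ ((n : ℤ) * (n - 1) / 2) * r ^ n := by
  refine summable_of_ratio_test_tendsto_lt_one (l := 0) one_pos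
    (Eventually.of_forall fun n => by positivity) ?_
  have h : (fun n : ℕ => ‖q ^ (((n + 1 : ℕ) : ℤ) * ((n + 1 : ℕ) - 1) / 2) * r ^ (n + 1)‖ /
      ‖q ^ ((n : ℤ) * (n - 1) / 2) * r ^ n‖) = fun n : ℕ => q ^ n * r := by
    funext n
    have e : ((n + 1 : ℕ) : ℤ) * ((n + 1 : ℕ) - 1) / 2 = (n : ℤ) * (n - 1) / 2 + n := by
      have := triangular_add n 1
      push_cast
      simpa using this
    rw [e, zpow_add₀ hq.ne', Real.norm_of_nonneg (by positivity),
      Real.norm_of_nonneg (by positivity), pow_succ, zpow_natCast]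
    field_simp
  rw [h]
  simpa using (tendsto_pow_atTop_nhds_zero_of_lt_one hq.le hq1).mul_const r

theorem summable_triangular {q r : ℝ} (hq : 0 < q) (hq1 : q < 1) (hr : 0 < r) :
    Summable fun j : ℤ => q ^ (j * (j - 1) / 2) * r ^ j := by
  refine Summable.of_nat_of_neg ?_ ?_
  · simpa using summable_triangular_nat hq hq1 hr
  · refine (summable_triangular_nat hq hq1 (div_pos hq hr)).congr fun n => ?_
    have e : (-(n : ℤ)) * (-(n : ℤ) - 1) / 2 = (n : ℤ) * (n - 1) / 2 + n := by
      have := triangular_add n 1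
      rw [show (-(n : ℤ)) * (-(n : ℤ) - 1) = (n + 1) * (n + 1 - 1) by ring]
      simpa using this
    rw [e, zpow_add₀ hq.ne', zpow_neg, zpow_natCast, zpow_natCast, div_pow]
    field_simp

theorem abs_intCast_le_zpow (j : ℤ) : |(j : ℝ)| ≤ 2 ^ j + (1 / 2 : ℝ) ^ j := by
  have key : ∀ n : ℕ, (n : ℝ) ≤ 2 ^ n := fun n => by exact_mod_cast n.lt_two_pow_self.le
  rcases Int.eq_nat_or_neg j with ⟨n, rfl | rfl⟩
  · have : (0 : ℝ) < (1 / 2) ^ n := by positivity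
    simp only [Int.cast_natCast, Nat.abs_cast, zpow_natCast]
    linarith [key n]
  · have : (0 : ℝ) < (2 ^ n)⁻¹ := by positivity
    simp only [Int.cast_neg, Int.cast_natCast, abs_neg, Nat.abs_cast, zpow_neg, zpow_natCast,
      one_div, inv_pow, inv_inv]
    linarith [key n]

theorem summable_abs_mul_triangular {q r : ℝ} (hq : 0 < q) (hq1 : q < 1) (hr : 0 < r) :
    Summable fun j : ℤ => |(j : ℝ)| * (q ^ (j * (j - 1) / 2) * r ^ j) := by
  refine Summable.of_nonneg_of_le (fun j => by positivity) (fun j => ?_)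
    ((summable_triangular hq hq1 (r := 2 * r) (by positivity)).add
      (summable_triangular hq hq1 (r := 1 / 2 * r) (by positivity)))
  have h : 0 < q ^ (j * (j - 1) / 2) * r ^ j := by positivity
  refine (mul_le_mul_of_nonneg_right (abs_intCast_le_zpow j) h.le).trans (le_of_eq ?_)
  rw [mul_zpow, mul_zpow]
  ring

theorem zpow_le_zpow_add_zpow {a b w : ℝ} (ha : 0 < a) (haw : a ≤ w) (hwb : w ≤ b) (j : ℤ) :
    w ^ j ≤ a ^ j + b ^ j := by
  have hw := ha.trans_le haw
  have hb := hw.trans_le hwb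
  have h1 : 0 < a ^ j := zpow_pos ha _
  have h2 : 0 < b ^ j := zpow_pos hb _
  rcases le_total 0 j with hj | hj
  · linarith [zpow_le_zpow_left₀ hj hw.le hwb]
  · obtain ⟨k, rfl⟩ : ∃ k : ℤ, j = -k := ⟨-j, by ring⟩
    have : w ^ (-k) ≤ a ^ (-k) := by
      rw [zpow_neg, zpow_neg]
      exact inv_anti₀ (zpow_pos ha _) (zpow_le_zpow_left₀ (by omega) ha.le haw)
    linarith

theorem summable_mul_thetaTerm {q w M : ℝ} (hq : 0 < q) (hq1 : q < 1) (hw : 0 < w) {c : ℤ → ℝ}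
    (hc : ∀ n, |c n| ≤ M) : Summable fun j : ℤ => c j * thetaTerm q j w := by
  refine Summable.of_norm_bounded ((summable_triangular hq hq1 hw).mul_left M) fun j => ?_
  rw [Real.norm_eq_abs, abs_mul, abs_thetaTerm hq hw]
  exact mul_le_mul_of_nonneg_right (hc j) (by positivity)

theorem summable_thetaTerm {q w : ℝ} (hq : 0 < q) (hq1 : q < 1) (hw : 0 < w) :
    Summable fun j : ℤ => thetaTerm q j w := by
  simpa using summable_mul_thetaTerm (c := fun _ => 1) (M := 1) hq hq1 hw (by simp)

theorem summable_intCast_mul_thetaTerm {q w : ℝ} (hq : 0 < q) (hq1 : q < 1) (hw : 0 < w) :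
    Summable fun j : ℤ => (j : ℝ) * thetaTerm q j w := by
  refine Summable.of_norm_bounded (summable_abs_mul_triangular hq hq1 hw) fun j => ?_
  rw [Real.norm_eq_abs, abs_mul, abs_thetaTerm hq hw]

/-- Termwise differentiation of a bilateral theta-like series with bounded coefficients. -/
theorem hasDerivAt_tsum_mul_thetaTerm {q w M : ℝ} (hq : 0 < q) (hq1 : q < 1) (hw : 0 < w)
    {c : ℤ → ℝ} (hc : ∀ n, |c n| ≤ M) :
    HasDerivAt (fun z => ∑' j : ℤ, c j * thetaTerm q j z)
      (w⁻¹ * ∑' j : ℤ, (j : ℝ) * c j * thetaTerm q j w) w := by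
  have hM : 0 ≤ M := (abs_nonneg _).trans (hc 0)
  have hterm : ∀ (j : ℤ) (z : ℝ), z ∈ Set.Ioo (w / 2) (2 * w) →
      HasDerivAt (fun z => c j * thetaTerm q j z)
        (z⁻¹ * ((j : ℝ) * c j * thetaTerm q j z)) z := by
    intro j z hz
    have hz0 : 0 < z := by linarith [hz.1]
    have h := ((hasDerivAt_zpow j z (Or.inl hz0.ne')).const_mul
      ((-1) ^ j * q ^ (j * (j - 1) / 2))).const_mul (c j)
    refine h.congr_deriv ?_
    unfold thetaTerm
    rw [zpow_sub_one₀ hz0.ne']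
    ring
  have hsum : Summable fun j : ℤ => (w / 2)⁻¹ * (M *
      (|(j : ℝ)| * (q ^ (j * (j - 1) / 2) * (w / 2) ^ j) +
        |(j : ℝ)| * (q ^ (j * (j - 1) / 2) * (2 * w) ^ j))) :=
    (((summable_abs_mul_triangular hq hq1 (by positivity)).add
      (summable_abs_mul_triangular hq hq1 (by positivity))).mul_left M).mul_left _
  have hmem : w ∈ Set.Ioo (w / 2) (2 * w) := ⟨by linarith, by linarith⟩
  rw [← tsum_mul_left]
  refine hasDerivAt_tsum_of_isPreconnected hsum isOpen_Ioo isPreconnected_Ioo hterm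
    (fun j z hz => ?_) hmem (summable_mul_thetaTerm hq hq1 hw hc) hmem
  have hz0 : 0 < z := by linarith [hz.1]
  rw [Real.norm_eq_abs, abs_mul, abs_mul, abs_mul, abs_thetaTerm hq hz0, abs_inv, abs_of_pos hz0]
  have h1 := zpow_le_zpow_add_zpow (by positivity) hz.1.le hz.2.le j
  have h2 : z⁻¹ ≤ (w / 2)⁻¹ := inv_anti₀ (by positivity) hz.1.le
  calc z⁻¹ * (|(j : ℝ)| * |c j| * (q ^ (j * (j - 1) / 2) * z ^ j))
      ≤ (w / 2)⁻¹ * (|(j : ℝ)| * M *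
          (q ^ (j * (j - 1) / 2) * ((w / 2) ^ j + (2 * w) ^ j))) := by
        gcongr
        exact hc j
    _ = _ := by ring

theorem hasDerivAt_thetaSum {q w : ℝ} (hq : 0 < q) (hq1 : q < 1) (hw : 0 < w) :
    HasDerivAt (thetaSum q) (w⁻¹ * thetaEuler q w) w := by
  have h := hasDerivAt_tsum_mul_thetaTerm (c := fun _ => 1) (M := 1) hq hq1 hw (by simp)
  simp only [one_mul, mul_one] at h
  exact h

theorem continuousOn_thetaEuler {q : ℝ} (hq : 0 < q) (hq1 : q < 1) :
    ContinuousOn (thetaEuler q) (Set.Icc q 1) := by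
  refine continuousOn_tsum (u := fun j : ℤ => |(j : ℝ)| * (q ^ (j * (j - 1) / 2) * q ^ j) +
      |(j : ℝ)| * (q ^ (j * (j - 1) / 2) * 1 ^ j)) (fun j => ?_)
    ((summable_abs_mul_triangular hq hq1 hq).add
      (summable_abs_mul_triangular hq hq1 one_pos)) fun j w hw => ?_
  · unfold thetaTerm
    exact continuousOn_const.mul (continuousOn_const.mul
      (continuousOn_id.zpow₀ j fun w hw => Or.inl (hq.trans_le hw.1).ne'))
  · rw [Real.norm_eq_abs, abs_mul, abs_thetaTerm hq (hq.trans_le hw.1), ← mul_add, ← mul_add]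
    have := zpow_le_zpow_add_zpow hq hw.1 hw.2 j
    gcongr

/-- The reflection `j ↦ -j` of the summation index. -/
theorem thetaTerm_neg {q w : ℝ} (hq : 0 < q) (hw : 0 < w) (j : ℤ) :
    thetaTerm q (-j) (q / w) = thetaTerm q j w := by
  unfold thetaTerm
  have e : (-j) * (-j - 1) / 2 = j * (j - 1) / 2 + j := by
    have := triangular_add j 1
    rw [show (-j) * (-j - 1) = (j + 1) * (j + 1 - 1) by ring]
    simpa using this
  rw [e, zpow_add₀ hq.ne', zpow_neg, zpow_neg, div_zpow, ← inv_zpow, inv_neg, inv_one]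
  field_simp

theorem thetaEuler_div {q w : ℝ} (hq : 0 < q) (hw : 0 < w) :
    thetaEuler q (q / w) = -thetaEuler q w := by
  unfold thetaEuler
  rw [← (Equiv.neg ℤ).tsum_eq, ← tsum_neg]
  refine tsum_congr fun j => ?_
  rw [Equiv.neg_apply, thetaTerm_neg hq hw]
  push_cast
  ring

/-- The terms of index `j` and `1 - j` cancel at `w = 1`. -/
theorem thetaSum_one (q : ℝ) : thetaSum q 1 = 0 := by
  have h : thetaSum q 1 = -thetaSum q 1 := by
    unfold thetaSum
    conv_lhs => rw [← (Equiv.subLeft (1 : ℤ)).tsum_eq]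
    rw [← tsum_neg]
    refine tsum_congr fun j => ?_
    rw [Equiv.subLeft_apply]
    unfold thetaTerm
    rw [show (1 - j) * (1 - j - 1) = j * (j - 1) by ring, zpow_sub₀ (by norm_num), one_zpow,
      one_zpow, zpow_one, div_eq_mul_inv, ← inv_zpow, inv_neg, inv_one]
    ring
  linarith

/-- If `|d n| ≤ K r^n` then `∑ d (m+j) (-1)^j q^(j(j-1)/2) w^j = O(r^m)`, uniformly for
`w ∈ [q, 1]`. -/
theorem exists_abs_tsum_shift_le {q r K : ℝ} (hq : 0 < q) (hq1 : q < 1) (hr : 0 < r)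
    {d : ℤ → ℝ} (hd : ∀ n, |d n| ≤ K * r ^ n) :
    ∃ K', ∀ (m : ℕ) (w : ℝ), w ∈ Set.Icc q 1 →
      Summable (fun j : ℤ => d (m + j) * thetaTerm q j w) ∧
      |∑' j : ℤ, d (m + j) * thetaTerm q j w| ≤ K' * r ^ m := by
  have hK : 0 ≤ K := by simpa using (abs_nonneg _).trans (hd 0)
  have hs := (summable_triangular hq hq1 (mul_pos hr hq)).add
      (summable_triangular hq hq1 (mul_pos hr one_pos))
  refine ⟨K * ∑' j : ℤ, (q ^ (j * (j - 1) / 2) * (r * q) ^ j +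
      q ^ (j * (j - 1) / 2) * (r * 1) ^ j), fun m w hw => ?_⟩
  have hb : ∀ j : ℤ, ‖d (m + j) * thetaTerm q j w‖ ≤ K * r ^ m *
      (q ^ (j * (j - 1) / 2) * (r * q) ^ j + q ^ (j * (j - 1) / 2) * (r * 1) ^ j) := by
    intro j
    have hw0 := hq.trans_le hw.1
    rw [Real.norm_eq_abs, abs_mul, abs_thetaTerm hq hw0]
    have h1 := zpow_le_zpow_add_zpow hq hw.1 hw.2 j
    calc |d (m + j)| * (q ^ (j * (j - 1) / 2) * w ^ j)
        ≤ (K * r ^ ((m : ℤ) + j)) * (q ^ (j * (j - 1) / 2) * (q ^ j + 1 ^ j)) := by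
          gcongr
          exact hd _
      _ = _ := by
          rw [zpow_add₀ hr.ne', mul_zpow, mul_zpow, zpow_natCast]
          ring
  refine ⟨Summable.of_norm_bounded (hs.mul_left _) hb, ?_⟩
  refine (tsum_of_norm_bounded (hs.mul_left _).hasSum hb).trans (le_of_eq ?_)
  rw [tsum_mul_left]
  ring

/-! ### The coefficients of the bilateral series -/

theorem qShiftedFactorial_succ (a q : ℝ) (n : ℕ) :
    qShiftedFactorial a q (n + 1) = qShiftedFactorial a q n * (1 - a * q ^ n) :=
  Finset.prod_range_succ _ _

theorem mul_pow_le_self {a q : ℝ} (hq : 0 < q) (hq1 : q < 1) (ha : 0 ≤ a) (n : ℕ) :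
    a * q ^ n ≤ a :=
  mul_le_of_le_one_right ha (pow_le_one₀ hq.le hq1.le)

theorem qShiftedFactorial_pos {a q : ℝ} (hq : 0 < q) (hq1 : q < 1) (ha : 0 ≤ a) (ha1 : a < 1)
    (n : ℕ) : 0 < qShiftedFactorial a q n :=
  Finset.prod_pos fun k _ => by linarith [mul_pow_le_self hq hq1 ha k]

theorem qShiftedFactorial_le_one {a q : ℝ} (hq : 0 < q) (hq1 : q < 1) (ha : 0 ≤ a) (ha1 : a < 1)
    (n : ℕ) : qShiftedFactorial a q n ≤ 1 :=
  Finset.prod_le_one (fun k _ => by linarith [mul_pow_le_self hq hq1 ha k])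
    fun k _ => by linarith [mul_nonneg ha (pow_nonneg hq.le k)]

/-- The products `(a;q)_n` are bounded away from `0`, i.e. `(a;q)_∞ > 0`. -/
theorem exists_pos_le_qShiftedFactorial {a q : ℝ} (hq : 0 < q) (hq1 : q < 1) (ha : 0 ≤ a)
    (ha1 : a < 1) : ∃ κ > 0, ∀ n, κ ≤ qShiftedFactorial a q n := by
  refine ⟨Real.exp (-(a / (1 - a) * (1 - q)⁻¹)), Real.exp_pos _, fun n => ?_⟩
  have h1a : 0 < 1 - a := by linarith
  have hfac : ∀ k : ℕ, Real.exp (-(a / (1 - a) * q ^ k)) ≤ 1 - a * q ^ k := by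
    intro k
    have hx := mul_pow_le_self hq hq1 ha k
    have hx0 : 0 ≤ a * q ^ k := mul_nonneg ha (pow_nonneg hq.le k)
    have hpos : 0 < 1 - a * q ^ k := by linarith
    rw [← Real.le_log_iff_exp_le hpos]
    refine le_trans ?_ (Real.one_sub_inv_le_log_of_pos hpos)
    have e : 1 - (1 - a * q ^ k)⁻¹ = -(a * q ^ k / (1 - a * q ^ k)) := by
      field_simp
      ring
    rw [e, neg_le_neg_iff, div_mul_eq_mul_div]
    exact div_le_div_of_nonneg_left hx0 h1a (by linarith)
  have hgeom : ∑ k ∈ Finset.range n, q ^ k ≤ (1 - q)⁻¹ := by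
    rw [← tsum_geometric_of_lt_one hq.le hq1]
    exact (summable_geometric_of_lt_one hq.le hq1).sum_le_tsum _
      fun k _ => pow_nonneg hq.le k
  calc Real.exp (-(a / (1 - a) * (1 - q)⁻¹))
      ≤ Real.exp (∑ k ∈ Finset.range n, -(a / (1 - a) * q ^ k)) := by
        rw [Finset.sum_neg_distrib, ← Finset.mul_sum]
        gcongr
    _ = ∏ k ∈ Finset.range n, Real.exp (-(a / (1 - a) * q ^ k)) := Real.exp_sum _ _
    _ ≤ qShiftedFactorial a q n :=
        Finset.prod_le_prod (fun k _ => (Real.exp_pos _).le) fun k _ => hfac k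

/-- The coefficient `1 / ((ω;q)_n (q;q)_n)`, extended to `n : ℤ` by `0` for `n < 0` so that the
series for `₁φ₁(0;ω;q,z)` becomes bilateral. -/
noncomputable def phiCoeff (ω q : ℝ) (n : ℤ) : ℝ :=
  if 0 ≤ n then (qShiftedFactorial ω q n.toNat * qShiftedFactorial q q n.toNat)⁻¹ else 0

theorem phiCoeff_natCast (ω q : ℝ) (n : ℕ) :
    phiCoeff ω q n = (qShiftedFactorial ω q n * qShiftedFactorial q q n)⁻¹ := by
  simp [phiCoeff]

theorem phiCoeff_of_neg (ω q : ℝ) {n : ℤ} (hn : n < 0) : phiCoeff ω q n = 0 :=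
  if_neg (by omega)

theorem phiCoeff_nonneg {ω q : ℝ} (hq : 0 < q) (hq1 : q < 1) (hω : 0 ≤ ω) (hω1 : ω < 1) (n : ℤ) :
    0 ≤ phiCoeff ω q n := by
  unfold phiCoeff
  split_ifs
  · exact (inv_pos.2 (mul_pos (qShiftedFactorial_pos hq hq1 hω hω1 _)
      (qShiftedFactorial_pos hq hq1 hq.le hq1 _))).le
  · exact le_rfl

theorem exists_phiCoeff_le {ω q : ℝ} (hq : 0 < q) (hq1 : q < 1) (hω : 0 ≤ ω) (hω1 : ω < 1) :
    ∃ M, ∀ n, |phiCoeff ω q n| ≤ M := by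
  obtain ⟨κ, hκ, h⟩ := exists_pos_le_qShiftedFactorial hq hq1 hω hω1
  obtain ⟨κ', hκ', h'⟩ := exists_pos_le_qShiftedFactorial hq hq1 hq.le hq1
  refine ⟨(κ * κ')⁻¹, fun n => ?_⟩
  rw [abs_of_nonneg (phiCoeff_nonneg hq hq1 hω hω1 n)]
  unfold phiCoeff
  split_ifs
  · exact inv_anti₀ (mul_pos hκ hκ') (mul_le_mul (h _) (h' _) hκ'.le (hκ.le.trans (h _)))
  · positivity

/-- The coefficients converge geometrically fast to their limit `1 / ((ω;q)_∞ (q;q)_∞)`. -/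
theorem exists_phiCoeff_natCast_sub_le {ω q : ℝ} (hq : 0 < q) (hq1 : q < 1) (hω : 0 ≤ ω)
    (hω1 : ω < 1) : ∃ C K : ℝ, 1 ≤ C ∧ 0 ≤ K ∧
      ∀ n : ℕ, |phiCoeff ω q n - C| ≤ K * q ^ n := by
  obtain ⟨M, hM⟩ := exists_phiCoeff_le hq hq1 hω hω1
  have hM0 : 0 ≤ M := (abs_nonneg _).trans (hM 0)
  have hstep : ∀ n : ℕ, dist (phiCoeff ω q n) (phiCoeff ω q (n + 1 : ℕ)) ≤ 2 * M * q ^ n := by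
    intro n
    have hx := mul_pow_le_self hq hq1 hω n
    have hx0 : 0 ≤ ω * q ^ n := mul_nonneg hω (pow_nonneg hq.le n)
    have hx1 : ω * q ^ n ≤ q ^ n := mul_le_of_le_one_left (pow_nonneg hq.le n) hω1.le
    have hy0 : 0 ≤ q * q ^ n := by positivity
    have hy1 : q * q ^ n ≤ q ^ n := mul_le_of_le_one_left (pow_nonneg hq.le n) hq1.le
    have hy := mul_pow_le_self hq hq1 hq.le n
    have e : phiCoeff ω q n = phiCoeff ω q (n + 1 : ℕ) * ((1 - ω * q ^ n) * (1 - q * q ^ n)) := by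
      rw [phiCoeff_natCast, phiCoeff_natCast, qShiftedFactorial_succ, qShiftedFactorial_succ]
      have h1 := (qShiftedFactorial_pos hq hq1 hω hω1 n).ne'
      have h2 := (qShiftedFactorial_pos hq hq1 hq.le hq1 n).ne'
      have h3 : 1 - ω * q ^ n ≠ 0 := by linarith
      have h4 : 1 - q * q ^ n ≠ 0 := by linarith
      generalize 1 - ω * q ^ n = x at h3 ⊢
      generalize 1 - q * q ^ n = y at h4 ⊢
      field_simp
    have e2 : phiCoeff ω q n - phiCoeff ω q (n + 1 : ℕ) =
        phiCoeff ω q (n + 1 : ℕ) * ((1 - ω * q ^ n) * (1 - q * q ^ n) - 1) := by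
      rw [e]
      ring
    rw [Real.dist_eq, e2, abs_mul]
    have hb : |(1 - ω * q ^ n) * (1 - q * q ^ n) - 1| ≤ 2 * q ^ n := by
      rw [abs_le]
      constructor <;> nlinarith
    calc _ ≤ M * (2 * q ^ n) := mul_le_mul (hM _) hb (abs_nonneg _) hM0
      _ = _ := by ring
  obtain ⟨C, hC⟩ := cauchySeq_tendsto_of_complete (cauchySeq_of_le_geometric q _ hq1 hstep)
  refine ⟨C, 2 * M / (1 - q), ge_of_tendsto hC (Eventually.of_forall fun n => ?_), ?_, fun n => ?_⟩
  · rw [phiCoeff_natCast]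
    exact (one_le_inv₀ (mul_pos (qShiftedFactorial_pos hq hq1 hω hω1 _)
      (qShiftedFactorial_pos hq hq1 hq.le hq1 _))).2 (mul_le_one₀
        (qShiftedFactorial_le_one hq hq1 hω hω1 _)
        (qShiftedFactorial_pos hq hq1 hq.le hq1 _).le
        (qShiftedFactorial_le_one hq hq1 hq.le hq1 _))
  · exact div_nonneg (by positivity) (by linarith)
  · have := dist_le_of_le_geometric_of_tendsto q _ hq1 hstep hC n
    rw [Real.dist_eq] at this
    refine this.trans (le_of_eq ?_)
    ring

theorem exists_succ_mul_pow_le {x : ℝ} (hx : 0 ≤ x) (hx1 : x < 1) :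
    ∃ B, ∀ n : ℕ, ((n : ℝ) + 1) * x ^ n ≤ B := by
  have h : Tendsto (fun n : ℕ => ((n : ℝ) + 1) * x ^ n) atTop (𝓝 (0 + 0)) := by
    simp only [add_mul, one_mul]
    exact (tendsto_self_mul_const_pow_of_lt_one hx hx1).add
      (tendsto_pow_atTop_nhds_zero_of_lt_one hx hx1)
  obtain ⟨B, hB⟩ := h.bddAbove_range
  exact ⟨B, fun n => hB ⟨n, rfl⟩⟩

/-- A bilateral form of the convergence of the coefficients: the weight `|n| + 1` is absorbed by
enlarging the rate from `q` to some `r < 1`, and `r^n` is large for `n < 0`, where the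
coefficients vanish. -/
theorem exists_phiCoeff_sub_le {ω q : ℝ} (hq : 0 < q) (hq1 : q < 1) (hω : 0 ≤ ω)
    (hω1 : ω < 1) : ∃ C K r : ℝ, 1 ≤ C ∧ 0 < r ∧ r < 1 ∧
      ∀ n : ℤ, (|(n : ℝ)| + 1) * |phiCoeff ω q n - C| ≤ K * r ^ n := by
  obtain ⟨C, K, hC, hK, h⟩ := exists_phiCoeff_natCast_sub_le hq hq1 hω hω1
  obtain ⟨r, hqr, hr1⟩ := exists_between hq1
  have hr : 0 < r := hq.trans hqr
  obtain ⟨B₁, hB₁⟩ := exists_succ_mul_pow_le (x := q / r) (by positivity) ((div_lt_one hr).2 hqr)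
  obtain ⟨B₂, hB₂⟩ := exists_succ_mul_pow_le hr.le hr1
  have h1 : 1 ≤ B₁ := by simpa using hB₁ 0
  have h2 : 1 ≤ B₂ := by simpa using hB₂ 0
  refine ⟨C, K * B₁ + C * B₂, r, hC, hr, hr1, fun n => ?_⟩
  have hrn : 0 < r ^ n := zpow_pos hr n
  rcases lt_or_ge n 0 with hn | hn
  · obtain ⟨k, rfl⟩ : ∃ k : ℕ, n = -(k : ℤ) := ⟨n.natAbs, by omega⟩
    rw [phiCoeff_of_neg _ _ hn, zero_sub, abs_neg, abs_of_pos (by linarith : 0 < C)]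
    have e : ((k : ℝ) + 1) ≤ B₂ * r ^ (-(k : ℤ)) := by
      have := mul_le_mul_of_nonneg_right (hB₂ k) hrn.le
      rw [mul_assoc, zpow_neg, zpow_natCast, mul_inv_cancel₀ (by positivity), mul_one] at this
      rwa [zpow_neg, zpow_natCast]
    have e' : 0 ≤ K * B₁ * r ^ (-(k : ℤ)) := by positivity
    simp only [Int.cast_neg, Int.cast_natCast, abs_neg, Nat.abs_cast]
    nlinarith
  · lift n to ℕ using hn
    have e : ((n : ℝ) + 1) * q ^ n ≤ B₁ * r ^ (n : ℤ) := by
      have := mul_le_mul_of_nonneg_right (hB₁ n) hrn.le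
      rwa [mul_assoc, zpow_natCast, div_pow, div_mul_cancel₀ _ (by positivity)] at this
    have e' : 0 ≤ C * B₂ * r ^ (n : ℤ) := by positivity
    simp only [Int.cast_natCast, Nat.abs_cast]
    calc ((n : ℝ) + 1) * |phiCoeff ω q n - C| ≤ (n + 1) * (K * q ^ n) := by
          gcongr
          exact h n
      _ = K * ((n + 1) * q ^ n) := by ring
      _ ≤ K * (B₁ * r ^ (n : ℤ)) := by gcongr
      _ ≤ _ := by linarith

theorem qShiftedFactorial_zero_left (q : ℝ) (n : ℕ) : qShiftedFactorial 0 q n = 1 := by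
  simp [qShiftedFactorial]

theorem basicPhi11_term_eq (ω q z : ℝ) (n : ℕ) :
    qShiftedFactorial 0 q n / (qShiftedFactorial ω q n * qShiftedFactorial q q n)
      * ((-1) ^ n * q ^ (n * (n - 1) / 2)) * z ^ n = phiCoeff ω q n * thetaTerm q n z := by
  have e : (n : ℤ) * (n - 1) / 2 = ((n * (n - 1) / 2 : ℕ) : ℤ) := by
    cases n with
    | zero => simp
    | succ k => simp
  rw [phiCoeff_natCast, qShiftedFactorial_zero_left]
  unfold thetaTerm
  rw [e, zpow_natCast, zpow_natCast, zpow_natCast]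
  ring

/-- The bilateral form of the series for `₁φ₁(0;ω;q,z)`. -/
theorem basicPhi11_eq_tsum_int (ω q z : ℝ) :
    basicPhi11 0 ω q z = ∑' n : ℤ, phiCoeff ω q n * thetaTerm q n z := by
  unfold basicPhi11
  simp only [basicPhi11_term_eq]
  refine Function.Injective.tsum_eq (f := fun n : ℤ => phiCoeff ω q n * thetaTerm q n z)
    Nat.cast_injective fun n hn => ?_
  rcases lt_or_ge n 0 with h | h
  · exact absurd (by simp [phiCoeff_of_neg ω q h]) hn
  · exact ⟨n.toNat, by simp [h]⟩

/-! ### Positivity of the theta function -/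

/-- The recursion `1/(q;q)_{n-1} = (1 - q^n)/(q;q)_n`, valid for all `n : ℤ`. -/
theorem phiCoeff_zero_sub_one {q : ℝ} (hq : 0 < q) (hq1 : q < 1) (n : ℤ) :
    phiCoeff 0 q (n - 1) = (1 - q ^ n) * phiCoeff 0 q n := by
  rcases lt_trichotomy n 0 with hn | rfl | hn
  · rw [phiCoeff_of_neg _ _ hn, phiCoeff_of_neg _ _ (by omega), mul_zero]
  · rw [phiCoeff_of_neg _ _ (by omega)]
    simp
  · obtain ⟨k, rfl⟩ : ∃ k : ℕ, n = (k + 1 : ℕ) := ⟨(n - 1).toNat, by omega⟩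
    rw [show (((k + 1 : ℕ) : ℤ) - 1) = (k : ℤ) by push_cast; ring, phiCoeff_natCast,
      phiCoeff_natCast, zpow_natCast, qShiftedFactorial_zero_left, qShiftedFactorial_zero_left,
      qShiftedFactorial_succ, pow_succ']
    have h2 := (qShiftedFactorial_pos hq hq1 hq.le hq1 k).ne'
    have h4 : 1 - q * q ^ k ≠ 0 := by linarith [mul_pow_le_self hq hq1 hq.le k]
    generalize 1 - q * q ^ k = y at h4 ⊢
    field_simp

/-- The shifted Euler series `∑_j (-1)^j q^(j(j-1)/2) w^j / (q;q)_{m+j}`. For `m = 0` it is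
`(w;q)_∞`; for `m → ∞` it tends to `thetaSum q w / (q;q)_∞`. -/
noncomputable def eulerShift (q : ℝ) (m : ℤ) (w : ℝ) : ℝ :=
  ∑' j : ℤ, phiCoeff 0 q (m + j) * thetaTerm q j w

theorem thetaTerm_succ {q w : ℝ} (hq : 0 < q) (hw : 0 < w) (j : ℤ) :
    thetaTerm q (j + 1) w = -(w * (q ^ j * thetaTerm q j w)) := by
  have e : (j + 1) * (j + 1 - 1) / 2 = j * (j - 1) / 2 + j := by simpa using triangular_add j 1
  unfold thetaTerm
  rw [e, zpow_add₀ (by norm_num), zpow_add₀ hq.ne', zpow_add₀ hw.ne', zpow_one, zpow_one]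
  ring

theorem eulerShift_eq_tsum_succ (q : ℝ) (m : ℤ) (w : ℝ) :
    eulerShift q m w = ∑' j : ℤ, phiCoeff 0 q (m + 1 + j) * thetaTerm q (j + 1) w := by
  unfold eulerShift
  rw [← (Equiv.addRight (1 : ℤ)).tsum_eq]
  refine tsum_congr fun j => ?_
  rw [Equiv.coe_addRight, show m + (j + 1) = m + 1 + j by ring]

theorem eulerShift_succ {q w : ℝ} (hq : 0 < q) (hq1 : q < 1) (hw : 0 < w) (m : ℤ) :
    eulerShift q (m + 1) w = (1 - q ^ (m + 1) / w) * eulerShift q m w := by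
  obtain ⟨M, hM⟩ := exists_phiCoeff_le hq hq1 le_rfl one_pos
  have hs := summable_mul_thetaTerm hq hq1 hw (c := fun j => phiCoeff 0 q (m + 1 + j))
    fun n => hM _
  have hs' := summable_mul_thetaTerm hq hq1 hw (c := fun j => phiCoeff 0 q (m + j))
    fun n => hM _
  have h : eulerShift q (m + 1) w - eulerShift q m w =
      -(q ^ (m + 1) / w) * ∑' j : ℤ, phiCoeff 0 q (m + 1 + j) * thetaTerm q (j + 1) w := by
    unfold eulerShift
    rw [← tsum_mul_left, ← hs.tsum_sub hs']
    refine tsum_congr fun j => ?_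
    have := phiCoeff_zero_sub_one hq hq1 (m + 1 + j)
    rw [show m + 1 + j - 1 = m + j by ring] at this
    rw [this, thetaTerm_succ hq hw, zpow_add₀ hq.ne' (m + 1) j]
    field_simp
    ring
  rw [← eulerShift_eq_tsum_succ] at h
  linear_combination h

theorem eulerShift_neg_one {q w : ℝ} (hq : 0 < q) (hw : 0 < w) :
    eulerShift q (-1) w = -w * eulerShift q 0 (q * w) := by
  rw [eulerShift_eq_tsum_succ]
  unfold eulerShift
  rw [← tsum_mul_left]
  refine tsum_congr fun j => ?_
  have := thetaTerm_scale q 1 j w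
  rw [zpow_one] at this
  rw [this, thetaTerm_succ hq hw, show (-1 : ℤ) + 1 = 0 by norm_num]
  ring

/-- The functional equation `(w;q)_∞ = (1 - w) (qw;q)_∞`. -/
theorem eulerShift_zero_eq {q w : ℝ} (hq : 0 < q) (hq1 : q < 1) (hw : 0 < w) :
    eulerShift q 0 w = (1 - w) * eulerShift q 0 (q * w) := by
  have h := eulerShift_succ hq hq1 hw (-1)
  rw [eulerShift_neg_one hq hw, show (-1 : ℤ) + 1 = 0 by norm_num, zpow_zero] at h
  rw [h]
  field_simp
  ring

theorem eulerShift_zero_eq_mul {q w : ℝ} (hq : 0 < q) (hq1 : q < 1) (hw : 0 < w) (n : ℕ) :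
    eulerShift q 0 w = qShiftedFactorial w q n * eulerShift q 0 (q ^ n * w) := by
  induction n with
  | zero => simp [qShiftedFactorial]
  | succ k ih =>
    rw [ih, eulerShift_zero_eq hq hq1 (by positivity), qShiftedFactorial_succ, pow_succ', mul_assoc,
      mul_assoc, mul_comm w]

theorem tendsto_eulerShift_zero {q w : ℝ} (hq : 0 < q) (hq1 : q < 1) (hw : 0 < w) (hw1 : w ≤ 1) :
    Tendsto (fun n : ℕ => eulerShift q 0 (q ^ n * w)) atTop (𝓝 1) := by
  obtain ⟨M, hM⟩ := exists_phiCoeff_le hq hq1 le_rfl one_pos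
  have hM0 : 0 ≤ M := (abs_nonneg _).trans (hM 0)
  have h1 : ∑' j : ℤ, (if j = 0 then (1 : ℝ) else 0) = 1 := tsum_ite_eq 0 _
  conv => rw [← h1]
  refine tendsto_tsum_of_dominated_convergence
    (bound := fun j : ℤ => M * (q ^ (j * (j - 1) / 2) * 1 ^ j))
    ((summable_triangular hq hq1 one_pos).mul_left M) (fun j => ?_)
    (Eventually.of_forall fun n j => ?_)
  · simp only [zero_add]
    rcases lt_trichotomy j 0 with hj | rfl | hj
    · simp [phiCoeff_of_neg _ _ hj, hj.ne]
    · simp [phiCoeff, thetaTerm, qShiftedFactorial]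
    · lift j to ℕ using hj.le
      have hj' : j ≠ 0 := by omega
      have ht : Tendsto (fun n : ℕ => (q ^ n * w) ^ j) atTop (𝓝 0) := by
        have := ((tendsto_pow_atTop_nhds_zero_of_lt_one hq.le hq1).mul_const w).pow j
        simpa [hj'] using this
      have := (ht.const_mul ((-1) ^ (j : ℤ) * q ^ ((j : ℤ) * (j - 1) / 2))).const_mul
        (phiCoeff 0 q j)
      simpa [thetaTerm, hj'] using this
  · have hz : 0 < q ^ n * w := by positivity
    have hz1 : q ^ n * w ≤ 1 := mul_le_one₀ (pow_le_one₀ hq.le hq1.le) hw.le hw1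
    rw [zero_add, Real.norm_eq_abs, abs_mul, abs_thetaTerm hq hz]
    rcases lt_or_ge j 0 with hj | hj
    · rw [phiCoeff_of_neg _ _ hj, abs_zero, zero_mul]
      positivity
    · have h2 := hM j
      have h3 := zpow_le_zpow_left₀ hj hz.le hz1
      gcongr

/-- `(w;q)_∞ ≥ κ (1 - w)` on `(0, 1]`. -/
theorem exists_le_eulerShift_zero {q : ℝ} (hq : 0 < q) (hq1 : q < 1) :
    ∃ κ > 0, (∀ n, κ ≤ qShiftedFactorial q q n) ∧
      ∀ w, 0 < w → w ≤ 1 → κ * (1 - w) ≤ eulerShift q 0 w := by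
  obtain ⟨κ, hκ, h⟩ := exists_pos_le_qShiftedFactorial hq hq1 hq.le hq1
  refine ⟨κ, hκ, h, fun w hw hw1 => ?_⟩
  have hqw : 0 < q * w := by positivity
  have hqw1 : q * w ≤ q := mul_le_of_le_one_right hq.le hw1
  suffices hs : κ ≤ eulerShift q 0 (q * w) by
    rw [eulerShift_zero_eq hq hq1 hw, mul_comm κ]
    exact mul_le_mul_of_nonneg_left hs (by linarith)
  have ht := tendsto_eulerShift_zero hq hq1 hqw (hqw1.trans hq1.le)
  have ht' := ht.const_mul κ
  rw [mul_one] at ht'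
  refine le_of_tendsto ht' ?_
  filter_upwards [ht.eventually (lt_mem_nhds one_pos)] with n hn
  rw [eulerShift_zero_eq_mul hq hq1 hqw n]
  refine mul_le_mul_of_nonneg_right ((h n).trans ?_) hn.le
  refine Finset.prod_le_prod (fun k _ => ?_) fun k _ => ?_
  · linarith [mul_pow_le_self hq hq1 hq.le k]
  · linarith [mul_le_mul_of_nonneg_right hqw1 (pow_nonneg hq.le k)]

theorem eulerShift_natCast_eq {q w : ℝ} (hq : 0 < q) (hq1 : q < 1) (hw : 0 < w) (m : ℕ) :
    eulerShift q m w = qShiftedFactorial (q / w) q m * eulerShift q 0 w := by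
  induction m with
  | zero => simp [qShiftedFactorial]
  | succ k ih =>
    rw [Nat.cast_succ, eulerShift_succ hq hq1 hw, ih, qShiftedFactorial_succ,
      zpow_add_one₀ hq.ne', zpow_natCast]
    ring

/-- A lower bound for the theta function carrying the two zeros of the Jacobi triple product at
the ends of `[q, 1]`. It is inherited from the shifted Euler series, for which the product
`(q/w;q)_m (w;q)_∞` comes from a recursion in `m`. -/
theorem exists_le_thetaSum {q : ℝ} (hq : 0 < q) (hq1 : q < 1) :
    ∃ κ > 0, ∀ w ∈ Set.Icc q 1, κ * (1 - w) * (1 - q / w) ≤ thetaSum q w := by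
  obtain ⟨κ, hκ, hfac, he⟩ := exists_le_eulerShift_zero hq hq1
  obtain ⟨C, K, r, hC, hr, hr1, hd⟩ := exists_phiCoeff_sub_le hq hq1 le_rfl one_pos
  have hd' : ∀ n : ℤ, |phiCoeff 0 q n - C| ≤ K * r ^ n := fun n =>
    (le_mul_of_one_le_left (abs_nonneg _) (by linarith [abs_nonneg (n : ℝ)])).trans (hd n)
  obtain ⟨K', hK'⟩ := exists_abs_tsum_shift_le hq hq1 hr hd'
  have hC0 : 0 < C := by linarith
  refine ⟨κ * κ / C, by positivity, fun w hw => ?_⟩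
  have hw0 : 0 < w := hq.trans_le hw.1
  have hqw : 0 ≤ 1 - q / w := sub_nonneg.2 ((div_le_one hw0).2 hw.1)
  -- The shifted Euler series converge to `C * thetaSum q w`.
  have hlim : Tendsto (fun m : ℕ => eulerShift q m w) atTop (𝓝 (C * thetaSum q w)) := by
    rw [tendsto_iff_dist_tendsto_zero]
    refine squeeze_zero (fun _ => dist_nonneg) (fun m => ?_)
      (by simpa using (tendsto_pow_atTop_nhds_zero_of_lt_one hr.le hr1).const_mul K')
    obtain ⟨hs, hb⟩ := hK' m w hw
    have e : eulerShift q m w - C * thetaSum q w =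
        ∑' j : ℤ, (phiCoeff 0 q (m + j) - C) * thetaTerm q j w := by
      have h1 := (hs.hasSum.add ((summable_thetaTerm hq hq1 hw0).hasSum.mul_left C)).tsum_eq
      simp only [sub_mul, sub_add_cancel] at h1
      unfold eulerShift thetaSum
      rw [h1]
      simp only [sub_mul, add_sub_cancel_right]
    rw [Real.dist_eq, e]
    exact hb
  have hlow : κ * κ * (1 - w) * (1 - q / w) ≤ C * thetaSum q w := by
    refine ge_of_tendsto hlim ?_
    filter_upwards [eventually_ge_atTop 1] with m hm
    obtain ⟨k, rfl⟩ : ∃ k, m = k + 1 := ⟨m - 1, by omega⟩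
    have hprod : (1 - q / w) * κ ≤ qShiftedFactorial (q / w) q (k + 1) := by
      unfold qShiftedFactorial
      rw [Finset.prod_range_succ', pow_zero, mul_one, mul_comm]
      refine mul_le_mul_of_nonneg_right ((hfac k).trans ?_) hqw
      refine Finset.prod_le_prod (fun i _ => ?_) fun i _ => ?_
      · linarith [mul_pow_le_self hq hq1 hq.le i]
      · have : q / w * q ^ (i + 1) ≤ 1 * q ^ (i + 1) := by
          gcongr
          linarith
        linarith [pow_succ' q i]
    rw [eulerShift_natCast_eq hq hq1 hw0]
    calc κ * κ * (1 - w) * (1 - q / w) = ((1 - q / w) * κ) * (κ * (1 - w)) := by ring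
      _ ≤ _ := mul_le_mul hprod (he w hw0 hw.2)
          (mul_nonneg hκ.le (by linarith [hw.2]))
          ((mul_nonneg hqw hκ.le).trans hprod)
  calc κ * κ / C * (1 - w) * (1 - q / w) = (κ * κ * (1 - w) * (1 - q / w)) / C := by ring
    _ ≤ thetaSum q w := (div_le_iff₀' hC0).2 hlow

/-! ### Asymptotics and signs of the derivative -/

/-- The zero of the theta function at `w = 1` is simple. -/
theorem thetaEuler_one_neg {q : ℝ} (hq : 0 < q) (hq1 : q < 1) : thetaEuler q 1 < 0 := by
  obtain ⟨κ, hκ, h⟩ := exists_le_thetaSum hq hq1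
  have hd := (hasDerivAt_iff_tendsto_slope_left_right.1 (hasDerivAt_thetaSum hq hq1 one_pos)).1
  rw [inv_one, one_mul] at hd
  have hc : Tendsto (fun w : ℝ => -(κ * (1 - q / w))) (𝓝[<] 1) (𝓝 (-(κ * (1 - q / 1)))) := by
    have : ContinuousAt (fun w : ℝ => -(κ * (1 - q / w))) 1 := by
      fun_prop (disch := norm_num)
    exact this.tendsto.mono_left nhdsWithin_le_nhds
  have hle : thetaEuler q 1 ≤ -(κ * (1 - q / 1)) := by
    refine le_of_tendsto_of_tendsto hd hc ?_
    filter_upwards [Ioo_mem_nhdsLT hq1] with w hw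
    have h1 := h w ⟨hw.1.le, hw.2.le⟩
    have h2 : 0 < 1 - w := by linarith [hw.2]
    rw [slope_def_field, thetaSum_one, sub_zero, ← neg_sub 1 w, div_neg, neg_le_neg_iff,
      le_div_iff₀ h2]
    linarith
  rw [div_one] at hle
  have : 0 < κ * (1 - q) := mul_pos hκ (by linarith)
  linarith

/-- The asymptotics of the derivative: up to the explicit factor
`(-1)^m q^(-m(m+1)/2) w^m / z`, its value at `z = q^(-m) w` is
`C (m θ(w) + w θ'(w))` with an exponentially small error, uniformly on `[q, 1]`. -/
theorem exists_phiCoeff_shift_approx {ω q : ℝ} (hq : 0 < q) (hq1 : q < 1) (hω : 0 ≤ ω)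
    (hω1 : ω < 1) : ∃ C K r : ℝ, 1 ≤ C ∧ 0 < r ∧ r < 1 ∧ ∀ (m : ℕ), ∀ w ∈ Set.Icc q 1,
      |(∑' j : ℤ, ((m + j : ℤ) : ℝ) * phiCoeff ω q (m + j) * thetaTerm q j w) -
        C * (m * thetaSum q w + thetaEuler q w)| ≤ K * r ^ m := by
  obtain ⟨C, K, r, hC, hr, hr1, hd⟩ := exists_phiCoeff_sub_le hq hq1 hω hω1
  have hd' : ∀ n : ℤ, |(n : ℝ) * (phiCoeff ω q n - C)| ≤ K * r ^ n := fun n => by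
    rw [abs_mul]
    exact (mul_le_mul_of_nonneg_right (by linarith) (abs_nonneg _)).trans (hd n)
  obtain ⟨K', hK'⟩ := exists_abs_tsum_shift_le hq hq1 hr hd'
  refine ⟨C, K', r, hC, hr, hr1, fun m w hw => ?_⟩
  have hw0 : 0 < w := hq.trans_le hw.1
  obtain ⟨hs, hb⟩ := hK' m w hw
  refine le_trans (le_of_eq ?_) hb
  congr 1
  have h1 := (hs.hasSum.add ((((summable_thetaTerm hq hq1 hw0).hasSum.mul_left (m : ℝ)).add
    (summable_intCast_mul_thetaTerm hq hq1 hw0).hasSum).mul_left C)).tsum_eq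
  rw [sub_eq_iff_eq_add]
  unfold thetaSum thetaEuler
  rw [← h1]
  refine tsum_congr fun j => ?_
  push_cast
  ring

/-- For positive `z = q^(-m) w`, the sign of the derivative is `(-1)^m` times that of a
bilateral sum centred at its largest terms, those of index near `m`. -/
theorem sign_deriv_basicPhi11 {ω q w : ℝ} (hq : 0 < q) (hq1 : q < 1) (hω : 0 ≤ ω) (hω1 : ω < 1)
    (hw : 0 < w) (m : ℕ) :
    Real.sign (deriv (fun z : ℝ => basicPhi11 0 ω q z) (q ^ (-(m : ℤ)) * w)) = (-1) ^ m *
      Real.sign (∑' j : ℤ, ((m + j : ℤ) : ℝ) * phiCoeff ω q (m + j) * thetaTerm q j w) := by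
  obtain ⟨M, hM⟩ := exists_phiCoeff_le hq hq1 hω hω1
  have hz : 0 < q ^ (-(m : ℤ)) * w := by positivity
  have hd := (hasDerivAt_tsum_mul_thetaTerm hq hq1 hz hM).deriv
  simp only [basicPhi11_eq_tsum_int]
  rw [hd]
  have hshift : ∑' j : ℤ, (j : ℝ) * phiCoeff ω q j * thetaTerm q j (q ^ (-(m : ℤ)) * w) =
      thetaTerm q m (q ^ (-(m : ℤ)) * w) *
        ∑' j : ℤ, ((m + j : ℤ) : ℝ) * phiCoeff ω q (m + j) * thetaTerm q j w := by
    rw [← (Equiv.addLeft (m : ℤ)).tsum_eq, ← tsum_mul_left]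
    refine tsum_congr fun j => ?_
    rw [Equiv.coe_addLeft, thetaTerm_add hq hz, ← mul_assoc (q ^ (m : ℤ)), ← zpow_add₀ hq.ne',
      add_neg_cancel, zpow_zero, one_mul]
    ring
  rw [hshift]
  set S := ∑' j : ℤ, ((m + j : ℤ) : ℝ) * phiCoeff ω q (m + j) * thetaTerm q j w
  set z := q ^ (-(m : ℤ)) * w
  have hp : 0 < z⁻¹ * (q ^ ((m : ℤ) * (m - 1) / 2) * z ^ (m : ℤ)) := by positivity
  have e : z⁻¹ * (thetaTerm q m z * S) =
      (-1) ^ m * (z⁻¹ * (q ^ ((m : ℤ) * (m - 1) / 2) * z ^ (m : ℤ)) * S) := by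
    unfold thetaTerm
    rw [zpow_natCast (-1)]
    ring
  have hs : Real.sign (z⁻¹ * (q ^ ((m : ℤ) * (m - 1) / 2) * z ^ (m : ℤ)) * S) = Real.sign S := by
    rcases lt_trichotomy S 0 with h | h | h
    · rw [Real.sign_of_neg h, Real.sign_of_neg (mul_neg_of_pos_of_neg hp h)]
    · rw [h, mul_zero]
    · rw [Real.sign_of_pos h, Real.sign_of_pos (mul_pos hp h)]
  rw [e, ← hs]
  rcases neg_one_pow_eq_or ℝ m with h | h <;> rw [h]
  · rw [one_mul, one_mul]
  · rw [neg_one_mul, neg_one_mul, Real.sign_neg]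

theorem rpow_mem_Icc {q τ : ℝ} (hq : 0 < q) (hq1 : q < 1) (h0 : 0 ≤ τ) (h1 : τ ≤ 1) :
    q ^ τ ∈ Set.Icc q 1 :=
  ⟨by simpa using Real.rpow_le_rpow_of_exponent_ge hq hq1.le h1,
    Real.rpow_le_one hq.le hq1.le h0⟩

/-- If `m τ` is small, the term `m θ(q^τ)` is dominated by `w θ'(w) → θ'(1) < 0`. -/
theorem exists_eventually_theta_neg {q : ℝ} (hq : 0 < q) (hq1 : q < 1) :
    ∃ η > 0, ∃ ε > 0, ∀ᶠ m : ℕ in atTop, ∀ τ : ℝ, 0 ≤ τ → τ ≤ 1 → m * τ ≤ ε →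
      m * thetaSum q (q ^ τ) + thetaEuler q (q ^ τ) ≤ -η := by
  have hγ := thetaEuler_one_neg hq hq1
  obtain ⟨A, hA, hO⟩ := (hasDerivAt_thetaSum hq hq1 one_pos).isBigO_sub.exists_pos
  have hO' := hO.bound
  simp only [thetaSum_one, sub_zero, Real.norm_eq_abs] at hO'
  have hE : ∀ᶠ w in 𝓝[Set.Icc q 1] 1, thetaEuler q w < thetaEuler q 1 / 2 :=
    (continuousOn_thetaEuler hq hq1 1 ⟨hq1.le, le_rfl⟩).eventually
      (gt_mem_nhds (by linarith))
  have hcont : Tendsto (fun τ : ℝ => q ^ τ) (𝓝 0) (𝓝 1) := by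
    have := (Real.continuousAt_const_rpow (b := 0) hq.ne').tendsto
    rwa [Real.rpow_zero] at this
  obtain ⟨δ, hδ, hball⟩ := Metric.eventually_nhds_iff.1
    (hcont.eventually (hO'.and (eventually_nhdsWithin_iff.1 hE)))
  have hL : 0 < -Real.log q := by linarith [Real.log_neg hq hq1]
  have hAL : 0 < A * -Real.log q := mul_pos hA hL
  refine ⟨-thetaEuler q 1 / 4, by linarith, -thetaEuler q 1 / 4 / (A * -Real.log q),
    div_pos (by linarith) hAL, ?_⟩
  set ε := -thetaEuler q 1 / 4 / (A * -Real.log q) with hε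
  have hlim : Tendsto (fun m : ℕ => ε / m) atTop (𝓝 0) := tendsto_const_div_atTop_nhds_zero_nat ε
  filter_upwards [hlim.eventually (gt_mem_nhds hδ), eventually_gt_atTop 0]
    with m hm hm0 τ hτ0 hτ1 hmτ
  have hm0' : (0 : ℝ) < m := by exact_mod_cast hm0
  have hτδ : τ < δ := lt_of_le_of_lt ((le_div_iff₀' hm0').2 hmτ) hm
  obtain ⟨h1, h2⟩ := hball (y := τ) (by rwa [Real.dist_eq, sub_zero, abs_of_nonneg hτ0])
  have hw := rpow_mem_Icc hq hq1 hτ0 hτ1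
  have h3 := h2 hw
  have h4 : |q ^ τ - 1| ≤ τ * -Real.log q := by
    rw [abs_sub_comm, abs_of_nonneg (sub_nonneg.2 hw.2), Real.rpow_def_of_pos hq]
    linarith [Real.add_one_le_exp (Real.log q * τ)]
  have h5 : m * thetaSum q (q ^ τ) ≤ -thetaEuler q 1 / 4 :=
    calc m * thetaSum q (q ^ τ) ≤ m * (A * (τ * -Real.log q)) := by
          have := (le_abs_self _).trans (h1.trans (mul_le_mul_of_nonneg_left h4 hA.le))
          gcongr
      _ = (m * τ) * (A * -Real.log q) := by ring
      _ ≤ ε * (A * -Real.log q) := by gcongr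
      _ = -thetaEuler q 1 / 4 := by rw [hε, div_mul_cancel₀ _ hAL.ne']
  linarith

/-- If `m τ` is large, `m θ(q^τ)` dominates as long as `q^τ` stays away from `q`; near `q` both
`θ(w)` and `w θ'(w)` are nonnegative, and the latter is bounded below. -/
theorem exists_eventually_theta_pos {q : ℝ} (hq : 0 < q) (hq1 : q < 1) :
    ∃ η > 0, ∃ B : ℝ, ∀ (m : ℕ) (τ : ℝ), 0 ≤ τ → τ ≤ 1 → B ≤ m * τ →
      η ≤ m * thetaSum q (q ^ τ) + thetaEuler q (q ^ τ) := by
  obtain ⟨κ, hκ, hθ⟩ := exists_le_thetaSum hq hq1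
  have hcont := continuousOn_thetaEuler hq hq1
  have hγ : 0 < thetaEuler q q := by
    have := thetaEuler_div (w := 1) hq one_pos
    rw [div_one] at this
    linarith [thetaEuler_one_neg hq hq1]
  obtain ⟨N, hN⟩ := isCompact_Icc.exists_bound_of_continuousOn hcont
  have hE : ∀ᶠ w in 𝓝[Set.Icc q 1] q, thetaEuler q q / 2 < thetaEuler q w :=
    (hcont q ⟨le_rfl, hq1.le⟩).eventually (lt_mem_nhds (by linarith))
  obtain ⟨δ, hδ, hball⟩ := Metric.eventually_nhds_iff.1 (eventually_nhdsWithin_iff.1 hE)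
  have hq' : 0 < 1 - q := by linarith
  have hD : 0 < κ * (1 - q) * δ := by positivity
  refine ⟨min 1 (thetaEuler q q / 2), lt_min one_pos (by linarith), (N + 1) / (κ * (1 - q) * δ),
    fun m τ hτ0 hτ1 hB => ?_⟩
  have hw := rpow_mem_Icc hq hq1 hτ0 hτ1
  have hθw := hθ _ hw
  have hNw := hN _ hw
  rw [Real.norm_eq_abs] at hNw
  -- Convexity of `τ ↦ q^τ`.
  have hconv : (1 - q) * τ ≤ 1 - q ^ τ := by
    have := rpow_one_add_le_one_add_mul_self (s := q - 1) (by linarith) hτ0 hτ1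
    rw [add_sub_cancel] at this
    linarith
  set w := q ^ τ
  have hw0 : 0 < w := hq.trans_le hw.1
  have hqw : 0 ≤ 1 - q / w := sub_nonneg.2 ((div_le_one hw0).2 hw.1)
  have h1w : 0 ≤ 1 - w := by linarith [hw.2]
  rcases lt_or_ge w (q + δ) with h | h
  · have h1 := hball (y := w) (by
      rw [Real.dist_eq, abs_of_nonneg (sub_nonneg.2 hw.1)]
      linarith) hw
    have h2 : 0 ≤ (m : ℝ) * thetaSum q w :=
      mul_nonneg m.cast_nonneg (le_trans (by positivity) hθw)
    exact (min_le_right _ _).trans (by linarith)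
  · have h1 : δ ≤ 1 - q / w := by
      rw [← div_self hw0.ne', ← sub_div, le_div_iff₀ hw0]
      nlinarith [hw.2]
    have h2 : N + 1 ≤ m * thetaSum q w :=
      calc N + 1 ≤ (m * τ) * (κ * (1 - q) * δ) := (div_le_iff₀ hD).1 hB
        _ = m * (κ * ((1 - q) * τ) * δ) := by ring
        _ ≤ m * (κ * (1 - w) * (1 - q / w)) := by gcongr
        _ ≤ m * thetaSum q w := by gcongr
    exact (min_le_left _ _).trans (by linarith [(abs_le.1 hNw).1])

theorem rpow_neg_natCast_add {q : ℝ} (hq : 0 < q) (m : ℕ) (τ : ℝ) :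
    q ^ (-(m : ℝ) + τ) = q ^ (-(m : ℤ)) * q ^ τ := by
  rw [Real.rpow_add hq, ← Real.rpow_intCast]
  push_cast
  rfl

/-- The sign of the derivative for small `m τ`, uniformly in `τ`. -/
theorem exists_eventually_sign_of_le {ω q : ℝ} (hq : 0 < q) (hq1 : q < 1) (hω : 0 ≤ ω)
    (hω1 : ω < 1) : ∃ ε > 0, ∀ᶠ m : ℕ in atTop, ∀ τ : ℝ, 0 ≤ τ → τ ≤ 1 → m * τ ≤ ε →
      Real.sign (deriv (fun z : ℝ => basicPhi11 0 ω q z) (q ^ (-(m : ℝ) + τ))) =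
        (-1) ^ (m + 1) := by
  obtain ⟨C, K, r, hC, hr, hr1, happ⟩ := exists_phiCoeff_shift_approx hq hq1 hω hω1
  obtain ⟨η, hη, ε, hε, hev⟩ := exists_eventually_theta_neg hq hq1
  have hlim := (tendsto_pow_atTop_nhds_zero_of_lt_one hr.le hr1).const_mul K
  rw [mul_zero] at hlim
  refine ⟨ε, hε, ?_⟩
  filter_upwards [hev, hlim.eventually (gt_mem_nhds hη)] with m hm hsmall τ h0 h1 hmτ
  have ha := (abs_le.1 (happ m _ (rpow_mem_Icc hq hq1 h0 h1))).2
  have hb := hm τ h0 h1 hmτ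
  rw [rpow_neg_natCast_add hq, sign_deriv_basicPhi11 hq hq1 hω hω1 (Real.rpow_pos_of_pos hq _),
    Real.sign_of_neg (by nlinarith), pow_succ]

/-- The sign of the derivative for large `m τ`, uniformly in `τ`. -/
theorem exists_eventually_sign_of_ge {ω q : ℝ} (hq : 0 < q) (hq1 : q < 1) (hω : 0 ≤ ω)
    (hω1 : ω < 1) : ∃ B : ℝ, ∀ᶠ m : ℕ in atTop, ∀ τ : ℝ, 0 ≤ τ → τ ≤ 1 → B ≤ m * τ →
      Real.sign (deriv (fun z : ℝ => basicPhi11 0 ω q z) (q ^ (-(m : ℝ) + τ))) =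
        (-1) ^ m := by
  obtain ⟨C, K, r, hC, hr, hr1, happ⟩ := exists_phiCoeff_shift_approx hq hq1 hω hω1
  obtain ⟨η, hη, B, hev⟩ := exists_eventually_theta_pos hq hq1
  have hlim := (tendsto_pow_atTop_nhds_zero_of_lt_one hr.le hr1).const_mul K
  rw [mul_zero] at hlim
  refine ⟨B, ?_⟩
  filter_upwards [hlim.eventually (gt_mem_nhds hη)] with m hsmall τ h0 h1 hmτ
  have ha := (abs_le.1 (happ m _ (rpow_mem_Icc hq hq1 h0 h1))).1
  have hb := hev m τ h0 h1 hmτ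
  rw [rpow_neg_natCast_add hq, sign_deriv_basicPhi11 hq hq1 hω hω1 (Real.rpow_pos_of_pos hq _),
    Real.sign_of_pos (by nlinarith), mul_one]

/-- Signs, for large `m`, of the `z`-derivative of `₁φ₁(0;ω;q,z)` at `z = q^(-m+τ_m)`, and
constancy of its sign on the open intervals between `q^(-m+τ_m)` and `q^(-m)`. -/
theorem theorem3p7 (q ω : ℝ) (hq0 : 0 < q) (hq1 : q < 1) (hω0 : 0 ≤ ω) (hω1 : ω < 1) :
    (∀ τ : ℕ → ℝ, (∀ m : ℕ, 1 ≤ m → 0 ≤ τ m ∧ τ m < 1) →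
      (Tendsto (fun m : ℕ => (m : ℝ) * τ m) atTop (𝓝 0) →
        ∀ᶠ m : ℕ in atTop,
          Real.sign (deriv (fun z : ℝ => basicPhi11 0 ω q z) (q ^ (-(m : ℝ) + τ m)))
            = (-1) ^ (m + 1)) ∧
      (Tendsto (fun m : ℕ => (m : ℝ) * τ m) atTop atTop →
        ∀ᶠ m : ℕ in atTop,
          Real.sign (deriv (fun z : ℝ => basicPhi11 0 ω q z) (q ^ (-(m : ℝ) + τ m)))
            = (-1) ^ m)) ∧
    (∀ τ : ℕ → ℝ, Tendsto (fun m : ℕ => (m : ℝ) * τ m) atTop (𝓝 0) →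
      ∀ᶠ m : ℕ in atTop,
        ∀ z ∈ Set.Ioo (q ^ (-(m : ℝ) + τ m)) (q ^ (-(m : ℝ))),
          Real.sign (deriv (fun z : ℝ => basicPhi11 0 ω q z) z) = (-1) ^ (m + 1)) := by
  obtain ⟨ε, hε, hneg⟩ := exists_eventually_sign_of_le hq0 hq1 hω0 hω1
  obtain ⟨B, hpos⟩ := exists_eventually_sign_of_ge hq0 hq1 hω0 hω1
  refine ⟨fun τ hτ => ⟨fun h => ?_, fun h => ?_⟩, fun τ h => ?_⟩
  · filter_upwards [hneg, h.eventually (gt_mem_nhds hε), eventually_ge_atTop 1] with m hm h1 h2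
    exact hm _ (hτ m h2).1 (hτ m h2).2.le h1.le
  · filter_upwards [hpos, h.eventually_ge_atTop B, eventually_ge_atTop 1] with m hm h1 h2
    exact hm _ (hτ m h2).1 (hτ m h2).2.le h1
  · filter_upwards [hneg, h.eventually (gt_mem_nhds hε), h.eventually (gt_mem_nhds one_pos),
      eventually_ge_atTop 1] with m hm h1 h2 h3 z hz
    have hm1 : (1 : ℝ) ≤ m := by exact_mod_cast h3
    have hz0 : 0 < z := (Real.rpow_pos_of_pos hq0 _).trans hz.1
    -- Every point of the interval is `q^(-m+σ)` with `0 < σ < τ m`.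
    obtain ⟨σ, rfl⟩ : ∃ σ : ℝ, q ^ (-(m : ℝ) + σ) = z :=
      ⟨m + Real.logb q z, by rw [neg_add_cancel_left, Real.rpow_logb hq0 hq1.ne hz0]⟩
    have hσ : σ < τ m := by
      have := (Real.rpow_lt_rpow_left_iff_of_base_lt_one hq0 hq1).1 hz.1
      linarith
    have hσ0 : 0 < σ := by
      have := (Real.rpow_lt_rpow_left_iff_of_base_lt_one hq0 hq1).1 hz.2
      linarith
    have hle : m * σ ≤ m * τ m := by gcongr
    exact hm σ hσ0.le (by nlinarith) (by linarith)
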